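/- Let $T,n$ be nonnegative integers and let $\epsilon_1,\dots,\epsilon_T$ be independent $n$-dimensional random vectors on a probability space $(\Omega,\mathcal F,\mathbb P)$, each standard normally distributed under $\mathbb P$. Let $A_t\in\mathbb R^n$, $B_{t,s}\in\mathbb R^{n\times n}$ ($1\le s\le t\le T$) and $\lambda_t\in\mathbb R^n$ be nonrandom with $\det B_{t,t}\neq 0$ for all $t$, and set $$G_t:=A_t+\sum_{s=1}^tB_{t,s}\epsilon_s,\qquad \mathcal G_t:=\sigma(G_1,\dots,G_t),\quad \mathcal G_0:=\{\emptyset,\Omega\},\qquad D_t:=\exp\Big\{\sum_{s=1}^t\big(\lambda_s^{\mathrm T}\epsilon_s-\tfrac12\lambda_s^{\mathrm T}\lambda_s\big)\Big\}.$$ Let $\mathbb Q$ be given by $d\mathbb Q/d\mathbb P=D_T$. Subscript $t$ on $\mathbb E^{\mathbb P},\mathbb E^{\mathbb Q},\operatorname{Var}^{\mathbb P}$ means conditioning on $\mathcal G_t$; (in)equalities between random variables hold $\mathbb P$-almost surely, $(x)_+:=\max(0,x)$, and empty sums are $0$. Let $M$ be a probability distribution on the Borel subsets of $(0,1)$ that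 either has a bounded density with respect to Lebesgue measure or has support bounded away from $0$ and $1$. For $t\in\{0,\dots,T-1\}$ let $$\rho_t(Z):=\int_0^1F_{t,-Z}^{-1}(u)\,dM(u),$$ where $F_{t,-Z}$ is the conditional distribution function of $-Z$ given $\mathcal G_t$ and $F^{-1}(u):=\min\{m\in\mathbb R:F(m)\ge u\}$. Let $\Phi$ be the standard normal distribution function and $r_0:=\int_0^1\Phi^{-1}(u)\,dM(u)$. Let $g_1,\dots,g_T\in\mathbb R^n$ be nonrandom, $X_t:=g_t^{\mathrm T}G_t$, and define $(V_t)_{t=0}^T$ by $V_T:=0$ and, for $t=T-1,\dots,0$, $$V_t:=R_t-\mathbb E^{\mathbb Q}_t\big[(R_t-X_{t+1}-V_{t+1})_+\big],\qquad R_t:=\rho_t(-X_{t+1}-V_{t+1}),$$ and set $C_t:=R_t-V_t$ for $t\in\{0,\dots,T-1\}$. Then $\mathbb Q$ is a probability measure, $\Phi^{-1}$ is $M$-integrable, the conditional quantile functions defining the $R_t$ are almost surely $M$-integrable, and all $X_t,V_t,R_t$ are $\mathbb Q$-integrable and lie in $L^p(\mathbb P)$ for all $p<\infty$. For $s\in\{1,\dots,T\}$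 let $\sigma_s\ge 0$ be the nonnegative root of $$\sigma_s^2=\operatorname{Var}^{\mathbb P}_{s-1}\Big(\sum_{u=s}^TX_u\Big)-\operatorname{Var}^{\mathbb P}_{s}\Big(\sum_{u=s}^TX_u\Big)=\sum_{j=s}^T\sum_{k=s}^Tg_j^{\mathrm T}B_{j,s}B_{k,s}^{\mathrm T}g_k$$ (the two expressions are equal). For all $t\in\{0,\dots,T\}$, $$V_t=\sum_{s=t+1}^T\mathbb E^{\mathbb Q}_t[X_s]+K^{\mathbb Q}_t=\sum_{s=t+1}^T\mathbb E^{\mathbb P}_t[X_s]+K^{\mathbb P}_t,$$ where, with $e_1$ a standard normal random variable, $$K^{\mathbb Q}_t=\sum_{s=t+1}^T\Big(\sigma_sr_0-\sum_{u=s}^Tg_u^{\mathrm T}B_{u,s}\lambda_s-\mathbb E\Big[\Big(\sigma_s(r_0-e_1)-\sum_{u=s}^Tg_u^{\mathrm T}B_{u,s}\lambda_s\Big)_+\Big]\Big),$$ $$K^{\mathbb P}_t=\sum_{s=t+1}^T\Big(\sigma_sr_0-\mathbb E\Big[\Big(\sigma_s(r_0-e_1)-\sum_{u=s}^Tg_u^{\mathrm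 T}B_{u,s}\lambda_s\Big)_+\Big]\Big).$$ Moreover, for all $t\in\{0,\dots,T-1\}$, $$C_t=\mathbb E\Big[\Big(\sigma_{t+1}(r_0-e_1)-\sum_{u=t+1}^Tg_u^{\mathrm T}B_{u,t+1}\lambda_{t+1}\Big)_+\Big].$$ -/

import Mathlib

open MeasureTheory ProbabilityTheory Matrix Set
open scoped NNReal ENNReal

noncomputable section

/-! ### Quantiles and quantile-type conditional risk measures -/

/-- The (lower) quantile function `F⁻¹(u) = min {x | F(x) ≥ u}`, `u ∈ (0,1)`, of a probability
measure `μ` on `ℝ` with distribution function `F`. -/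
def quantile (μ : Measure ℝ) (u : ℝ) : ℝ := sInf {x : ℝ | u ≤ cdf μ x}

/-- The inverse `Φ⁻¹` of the standard normal distribution function. -/
def stdNormalQuantile (u : ℝ) : ℝ := quantile (gaussianReal 0 1) u

/-- `M` is a probability distribution on the Borel subsets of `(0,1)` which either has a bounded
density with respect to Lebesgue measure or has support bounded away from `0` and `1`. -/
structure IsQuantileWeight (M : Measure ℝ) : Prop where
  isProbabilityMeasure : IsProbabilityMeasure M
  compl_Ioo : M (Ioo 0 1)ᶜ = 0
  density_or_support :
    (∃ (f : ℝ → ℝ≥0∞) (c : ℝ≥0), Measurable f ∧ (∀ x, f x ≤ c) ∧ M = volume.withDensity f) ∨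
    (∃ a b : ℝ, 0 < a ∧ b < 1 ∧ M (Icc a b)ᶜ = 0)

/-- The regular conditional distribution `P(Y ∈ · ∣ m)(ω)` of a real random variable `Y` given the
σ-algebra `m`. -/
def condLaw {Ω : Type*} {mΩ : MeasurableSpace Ω} (P : Measure Ω) [hP : IsFiniteMeasure P]
    (m : MeasurableSpace Ω) (Y : Ω → ℝ) (ω : Ω) : Measure ℝ :=
  @condDistrib Ω Ω ℝ _ _ _ mΩ m Y id P hP ω

/-- The conditional risk measure `ρ(Z) = ∫₀¹ F⁻¹_{-Z ∣ m}(u) dM(u)`, where `F_{-Z ∣ m}` is the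
conditional distribution function of `-Z` given `m`. -/
def riskMeasure {Ω : Type*} {mΩ : MeasurableSpace Ω} (P : Measure Ω) [IsFiniteMeasure P]
    (M : Measure ℝ) (m : MeasurableSpace Ω) (Z : Ω → ℝ) (ω : Ω) : ℝ :=
  ∫ u in Ioo 0 1, quantile (condLaw P m (-Z) ω) u ∂M

/-- The constant `r₀ = ∫₀¹ Φ⁻¹(u) dM(u)`. -/
def rZero (M : Measure ℝ) : ℝ := ∫ u in Ioo 0 1, stdNormalQuantile u ∂M

/-! ### The Gaussian model -/

/-- The data of an `n`-dimensional Gaussian model over the times `1, …, T`: independent `n`-dimensional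
standard normal vectors `ε₁, …, ε_T` under `P`, nonrandom `A_t`, `B_{t,s}` (`1 ≤ s ≤ t ≤ T`) with
`det B_{t,t} ≠ 0`, and nonrandom `λ_t`. Values at time indices outside `1, …, T` play no role. -/
structure GaussianModel {Ω : Type*} [MeasurableSpace Ω] (P : Measure Ω) (T n : ℕ) where
  ε : ℕ → Ω → Fin n → ℝ
  A : ℕ → Fin n → ℝ
  B : ℕ → ℕ → Matrix (Fin n) (Fin n) ℝ
  lam : ℕ → Fin n → ℝ
  measurable_ε : ∀ t ∈ Finset.Icc 1 T, Measurable (ε t)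
  hasLaw_ε : ∀ t ∈ Finset.Icc 1 T, HasLaw (ε t) (Measure.pi fun _ : Fin n => gaussianReal 0 1) P
  iIndepFun_ε : iIndepFun (fun t : Finset.Icc 1 T => ε t) P
  det_B_ne_zero : ∀ t ∈ Finset.Icc 1 T, (B t t).det ≠ 0

namespace GaussianModel

variable {Ω : Type*} [mΩ : MeasurableSpace Ω] {P : Measure Ω} {T n : ℕ}

/-- `G_t = A_t + ∑_{s=1}^t B_{t,s} ε_s`. -/
def G (𝓜 : GaussianModel P T n) (t : ℕ) (ω : Ω) : Fin n → ℝ :=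
  𝓜.A t + ∑ s ∈ Finset.Icc 1 t, 𝓜.B t s *ᵥ 𝓜.ε s ω

/-- The σ-algebra `𝒢_t` generated by `G_1, …, G_t` (trivial for `t = 0`). -/
@[reducible] def filt (𝓜 : GaussianModel P T n) (t : ℕ) : MeasurableSpace Ω :=
  ⨆ s ∈ Finset.Icc 1 t, MeasurableSpace.comap (𝓜.G s) inferInstance

/-- The density process `D_t = exp (∑_{s=1}^t (λ_sᵀ ε_s - ½ λ_sᵀ λ_s))`. -/
def D (𝓜 : GaussianModel P T n) (t : ℕ) (ω : Ω) : ℝ :=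
  Real.exp (∑ s ∈ Finset.Icc 1 t, (𝓜.lam s ⬝ᵥ 𝓜.ε s ω - 1 / 2 * (𝓜.lam s ⬝ᵥ 𝓜.lam s)))

/-- The pricing measure `Q`, with `dQ/dP = D_T`. -/
def Q (𝓜 : GaussianModel P T n) : Measure Ω :=
  P.withDensity fun ω => ENNReal.ofReal (𝓜.D T ω)

/-- The cash flow `X_t = g_tᵀ G_t`. -/
def X (𝓜 : GaussianModel P T n) (g : ℕ → Fin n → ℝ) (t : ℕ) (ω : Ω) : ℝ :=
  g t ⬝ᵥ 𝓜.G t ω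

/-! ### Valuation -/

/-- The conditional risk measure `ρ_t`, conditioning on `𝒢_t`. -/
def rho (𝓜 : GaussianModel P T n) [IsFiniteMeasure P] (M : Measure ℝ) (t : ℕ) (Z : Ω → ℝ) :
    Ω → ℝ :=
  riskMeasure P M (𝓜.filt t) Z

/-- `φ_t(Y) = ρ_t(-Y) - E^Q_t[(ρ_t(-Y) - Y)₊]`. -/
def phi (𝓜 : GaussianModel P T n) [IsFiniteMeasure P] (M : Measure ℝ) (t : ℕ) (Y : Ω → ℝ) :
    Ω → ℝ :=
  𝓜.rho M t (-Y) - 𝓜.Q[fun ω => max 0 (𝓜.rho M t (-Y) ω - Y ω) | 𝓜.filt t]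

/-- The residual liability value, defined by the backward recursion
`V_t = φ_t(X_{t+1} + V_{t+1})` for `t < T`, and `V_T = 0`. -/
def V (𝓜 : GaussianModel P T n) [IsFiniteMeasure P] (M : Measure ℝ) (g : ℕ → Fin n → ℝ) (t : ℕ) :
    Ω → ℝ :=
  if t < T then 𝓜.phi M t (𝓜.X g (t + 1) + V 𝓜 M g (t + 1)) else 0
termination_by T - t

/-- The capital requirement `R_t = ρ_t(-X_{t+1} - V_{t+1})`, `t < T`. -/
def R (𝓜 : GaussianModel P T n) [IsFiniteMeasure P] (M : Measure ℝ) (g : ℕ → Fin n → ℝ) (t : ℕ) :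
    Ω → ℝ :=
  𝓜.rho M t (-𝓜.X g (t + 1) - 𝓜.V M g (t + 1))

/-- The value `C_t = ρ_t(-X_{t+1} - V_{t+1}) - V_t`, `t < T`, of the reference undertaking. -/
def C (𝓜 : GaussianModel P T n) [IsFiniteMeasure P] (M : Measure ℝ) (g : ℕ → Fin n → ℝ) (t : ℕ) :
    Ω → ℝ :=
  𝓜.rho M t (-𝓜.X g (t + 1) - 𝓜.V M g (t + 1)) - 𝓜.V M g t

/-! ### The explicit constants -/

/-- `∑_{j=s}^T ∑_{k=s}^T g_jᵀ B_{j,s} B_{k,s}ᵀ g_k`. -/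
def sigmaSq (𝓜 : GaussianModel P T n) (g : ℕ → Fin n → ℝ) (s : ℕ) : ℝ :=
  ∑ j ∈ Finset.Icc s T, ∑ k ∈ Finset.Icc s T, g j ⬝ᵥ ((𝓜.B j s * (𝓜.B k s)ᵀ) *ᵥ g k)

/-- The nonnegative root `σ_s`. -/
def sigma (𝓜 : GaussianModel P T n) (g : ℕ → Fin n → ℝ) (s : ℕ) : ℝ := √(𝓜.sigmaSq g s)

/-- `∑_{u=s}^T g_uᵀ B_{u,s} λ_s`. -/
def drift (𝓜 : GaussianModel P T n) (g : ℕ → Fin n → ℝ) (s : ℕ) : ℝ :=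
  ∑ u ∈ Finset.Icc s T, g u ⬝ᵥ (𝓜.B u s *ᵥ 𝓜.lam s)

/-- `E[(σ_s (r₀ - e₁) - ∑_{u=s}^T g_uᵀ B_{u,s} λ_s)₊]` with `e₁` standard normal. -/
def callValue (𝓜 : GaussianModel P T n) (M : Measure ℝ) (g : ℕ → Fin n → ℝ) (s : ℕ) : ℝ :=
  ∫ e, max 0 (𝓜.sigma g s * (rZero M - e) - 𝓜.drift g s) ∂(gaussianReal 0 1)

/-- The constant `K^Q_t`. -/
def KQ (𝓜 : GaussianModel P T n) (M : Measure ℝ) (g : ℕ → Fin n → ℝ) (t : ℕ) : ℝ :=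
  ∑ s ∈ Finset.Icc (t + 1) T,
    (𝓜.sigma g s * rZero M - 𝓜.drift g s - 𝓜.callValue M g s)

/-- The constant `K^P_t`. -/
def KP (𝓜 : GaussianModel P T n) (M : Measure ℝ) (g : ℕ → Fin n → ℝ) (t : ℕ) : ℝ :=
  ∑ s ∈ Finset.Icc (t + 1) T, (𝓜.sigma g s * rZero M - 𝓜.callValue M g s)

end GaussianModel

end

/-!
The model is Gaussian and the recursion for `V` is affine in the innovations, so every `V_t` turns
out to be the `P`-conditional expectation of the remaining cash flow plus a nonrandom constant.

Since the matrices `B_{t,t}` are invertible, `𝒢_t` is generated by `ε_1, …, ε_t`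
(`filt_eq_iSup_comap_eps`), and is therefore independent of the later innovations. Write
`H_t = E^P_t[∑_{u>t} X_u]`, an affine functional of `ε_1, …, ε_t`. Assume `V_{t+1} = H_{t+1} + k`
with `k` nonrandom. Then `X_{t+1} + V_{t+1} = H_t + k + wᵀ ε_{t+1}` with `w = ∑_{u>t} B_{u,t+1}ᵀ g_u`
of squared length `σ_{t+1}²` (`X_add_affine_tail`). Its conditional law given `𝒢_t` is the image of
the standard normal law under `x ↦ H_t + k + σ_{t+1} x` (`condLaw_step`), and quantiles commute with
nondecreasing affine maps (`quantile_map_affine`), so that `R_t = H_t + k + σ_{t+1} r₀` (`rho_step`).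
The payoff `(R_t - X_{t+1} - V_{t+1})₊ = (σ_{t+1} r₀ - wᵀ ε_{t+1})₊` is independent of `𝒢_t` under
`Q`, where `wᵀ ε_{t+1}` is normal with mean `wᵀ λ_{t+1}` and variance `σ_{t+1}²`; its conditional
expectation is the constant `callValue` (`condExp_put_step`). This closes the backward induction
(`V_ae_eq`).

All facts under `Q` are instances of facts under `P`: under `Q` the shifted innovations `ε_s - λ_s`
form another Gaussian model with the same `G`, `B` and filtration (`shifted`). Comparing the two
models gives `∑_{s>t} E^Q_t[X_s] = H_t + ∑_{s>t} ∑_{u≥s} g_uᵀ B_{u,s} λ_s`, and the double sum is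
`K^P_t - K^Q_t`, so that the two representations of `V_t` agree.

Integrability of `Φ⁻¹` for a weight with bounded density follows from the quantile transform: at a
uniform variable `Φ⁻¹` is standard normal, hence integrable (`map_quantile`,
`integrableOn_quantile`).
-/

/-! ### Quantile functions -/

section Quantile

variable {μ : Measure ℝ}

lemma quantile_set_nonempty [IsProbabilityMeasure μ] {u : ℝ} (hu : u < 1) :
    {x : ℝ | u ≤ cdf μ x}.Nonempty :=
  (((tendsto_cdf_atTop μ).eventually (lt_mem_nhds hu)).exists).imp fun _ h => le_of_lt h

lemma quantile_set_bddBelow {u : ℝ} (hu : 0 < u) : BddBelow {x : ℝ | u ≤ cdf μ x} := by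
  obtain ⟨b, hb⟩ := ((tendsto_cdf_atBot μ).eventually (gt_mem_nhds hu)).exists
  refine ⟨b, fun x hx => le_of_not_gt fun hxb => ?_⟩
  exact absurd (hx.trans (monotone_cdf μ hxb.le)) (not_le.2 hb)

/-- The Galois connection between the quantile function and the distribution function. -/
lemma quantile_le_iff [IsProbabilityMeasure μ] {u : ℝ} (hu : u ∈ Ioo (0 : ℝ) 1) (x : ℝ) :
    quantile μ u ≤ x ↔ u ≤ cdf μ x := by
  refine ⟨fun h => ?_, fun h => csInf_le (quantile_set_bddBelow hu.1) h⟩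
  -- right continuity of the distribution function: `u ≤ F y` for all `y > x` gives `u ≤ F x`
  have hright : Filter.Tendsto (cdf μ) (nhdsWithin x (Ioi x)) (nhds (cdf μ x)) :=
    ((cdf μ).right_continuous x).tendsto.mono_left (nhdsWithin_mono x Ioi_subset_Ici_self)
  refine ge_of_tendsto hright ?_
  filter_upwards [self_mem_nhdsWithin] with y hy
  obtain ⟨z, hz, hzy⟩ := exists_lt_of_csInf_lt (quantile_set_nonempty hu.2) (lt_of_le_of_lt h hy)
  exact le_trans hz (monotone_cdf μ hzy.le)

lemma monotoneOn_quantile [IsProbabilityMeasure μ] : MonotoneOn (quantile μ) (Ioo 0 1) :=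
  fun _ hu _ hv huv =>
    csInf_le_csInf (quantile_set_bddBelow hu.1) (quantile_set_nonempty hv.2)
      fun _ hx => huv.trans hx

lemma aemeasurable_quantile [IsProbabilityMeasure μ] (ν : Measure ℝ) :
    AEMeasurable (quantile μ) (ν.restrict (Ioo 0 1)) :=
  aemeasurable_restrict_of_monotoneOn measurableSet_Ioo monotoneOn_quantile

/-- Quantile transform: the quantile function of `μ`, evaluated at a uniform variable, has
law `μ`. -/
lemma map_quantile [IsProbabilityMeasure μ] :
    (volume.restrict (Ioo (0 : ℝ) 1)).map (quantile μ) = μ := by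
  have hm := aemeasurable_quantile (μ := μ) volume
  have : IsProbabilityMeasure (volume.restrict (Ioo (0 : ℝ) 1)) := ⟨by simp⟩
  have : IsProbabilityMeasure ((volume.restrict (Ioo (0 : ℝ) 1)).map (quantile μ)) :=
    Measure.isProbabilityMeasure_map hm
  refine Measure.ext_of_Iic _ _ fun x => ?_
  rw [Measure.map_apply_of_aemeasurable hm measurableSet_Iic, ← ofReal_cdf]
  have h1 : volume.restrict (Ioo (0 : ℝ) 1) (quantile μ ⁻¹' Iic x)
      = volume.restrict (Ioo (0 : ℝ) 1) (Iic (cdf μ x)) := by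
    refine measure_congr ?_
    filter_upwards [ae_restrict_mem measurableSet_Ioo] with u hu
    exact propext (quantile_le_iff hu x)
  rw [h1, Measure.restrict_congr_set Ioo_ae_eq_Ioc, Measure.restrict_apply measurableSet_Iic]
  have h2 : Iic (cdf μ x) ∩ Ioc 0 1 = Ioc 0 (cdf μ x) := by
    ext u
    simp only [mem_inter_iff, mem_Iic, mem_Ioc]
    exact ⟨fun h => ⟨h.2.1, h.1⟩, fun h => ⟨h.2, h.1, h.2.trans (cdf_le_one μ x)⟩⟩
  rw [h2, Real.volume_Ioc, sub_zero]

/-- Quantiles are equivariant under nondecreasing affine maps. The degenerate scale `b = 0` is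
included, which is why `u` has to lie in `(0,1)`. -/
lemma quantile_map_affine [IsProbabilityMeasure μ] (a : ℝ) {b : ℝ} (hb : 0 ≤ b) {u : ℝ}
    (hu : u ∈ Ioo (0 : ℝ) 1) :
    quantile (μ.map fun x => a + b * x) u = a + b * quantile μ u := by
  have hm : Measurable fun x : ℝ => a + b * x := by fun_prop
  have : IsProbabilityMeasure (μ.map fun x => a + b * x) :=
    Measure.isProbabilityMeasure_map hm.aemeasurable
  refine eq_of_forall_ge_iff fun y => ?_
  rw [quantile_le_iff hu, cdf_eq_real, map_measureReal_apply hm measurableSet_Iic]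
  rcases hb.eq_or_lt with rfl | hb
  · by_cases hay : a ≤ y
    · simp [hay, hu.2.le]
    · simp [hay, hu.1]
  · have : (fun x : ℝ => a + b * x) ⁻¹' Iic y = Iic ((y - a) / b) := by
      ext x
      simp only [mem_preimage, mem_Iic, le_div_iff₀ hb]
      constructor <;> intro h <;> linarith
    rw [this, ← cdf_eq_real, ← quantile_le_iff hu, le_div_iff₀ hb]
    constructor <;> intro h <;> linarith

/-- The quantile function of an integrable distribution is integrable against the admissible
weights: for a bounded density by the quantile transform, for a support away from `0` and `1`
because a monotone function is bounded there. -/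
lemma integrableOn_quantile [IsProbabilityMeasure μ] (hμ : Integrable id μ) {M : Measure ℝ}
    (hM : IsQuantileWeight M) : IntegrableOn (quantile μ) (Ioo 0 1) M := by
  have := hM.isProbabilityMeasure
  rcases hM.density_or_support with ⟨f, c, hf, hfc, rfl⟩ | ⟨a, b, ha, hb, hab⟩
  · have h1 : IntegrableOn (quantile μ) (Ioo 0 1) volume := by
      rw [← map_quantile (μ := μ), integrable_map_measure (by fun_prop)
        (aemeasurable_quantile _)] at hμ
      exact hμ
    have h2 : (volume : Measure ℝ).withDensity f ≤ (c : ℝ≥0∞) • volume := by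
      rw [← withDensity_const]
      exact withDensity_mono (Filter.Eventually.of_forall hfc)
    exact (Integrable.smul_measure h1 ENNReal.coe_ne_top).mono_measure
      (by rw [← Measure.restrict_smul]; exact Measure.restrict_mono le_rfl h2)
  · have h1 : IntegrableOn (quantile μ) (Icc a b) M := by
      rcases le_or_gt a b with hle | hlt
      · refine MonotoneOn.integrableOn_isCompact isCompact_Icc ?_
        exact monotoneOn_quantile.mono fun x hx => ⟨ha.trans_le hx.1, hx.2.trans_lt hb⟩
      · simp [Icc_eq_empty_of_lt hlt]
    have h2 : IntegrableOn (quantile μ) (Icc a b ∪ (Icc a b)ᶜ) M :=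
      h1.union (by rw [IntegrableOn, Measure.restrict_eq_zero.2 hab]; exact integrable_zero_measure)
    exact h2.mono_set fun x _ => by simp

lemma integrableOn_stdNormalQuantile {M : Measure ℝ} (hM : IsQuantileWeight M) :
    IntegrableOn stdNormalQuantile (Ioo 0 1) M :=
  integrableOn_quantile ((memLp_id_gaussianReal' 1 ENNReal.one_ne_top).integrable le_rfl) hM

end Quantile

/-! ### Product densities and exponential tilting of Gaussian measures -/

lemma withDensity_pi {ι : Type*} [Fintype ι] {E : ι → Type*} [∀ i, MeasurableSpace (E i)]
    (μ : ∀ i, Measure (E i)) [∀ i, IsProbabilityMeasure (μ i)] {f : ∀ i, E i → ℝ≥0∞}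
    (hf : ∀ i, Measurable (f i)) [∀ i, SigmaFinite ((μ i).withDensity (f i))] :
    (Measure.pi μ).withDensity (fun x => ∏ i, f i (x i))
      = Measure.pi fun i => (μ i).withDensity (f i) := by
  refine (Measure.pi_eq fun s hs => ?_).symm
  rw [withDensity_apply _ (MeasurableSet.univ_pi hs), ← lintegral_indicator (.univ_pi hs)]
  have h1 : ∀ x, (univ.pi s).indicator (fun x => ∏ i, f i (x i)) x
      = ∏ i, (s i).indicator (f i) (x i) := by
    intro x
    by_cases hx : x ∈ univ.pi s
    · rw [indicator_of_mem hx]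
      exact Finset.prod_congr rfl fun i _ => (indicator_of_mem (hx i (mem_univ i)) _).symm
    · rw [indicator_of_notMem hx]
      simp only [mem_pi, mem_univ, true_implies, not_forall] at hx
      obtain ⟨i, hi⟩ := hx
      exact (Finset.prod_eq_zero (Finset.mem_univ i) (indicator_of_notMem hi _)).symm
  have hg : ∀ i, Measurable ((s i).indicator (f i)) := fun i => (hf i).indicator (hs i)
  simp_rw [h1]
  refine (lintegral_prod_eq_prod_lintegral_of_indepFun Finset.univ
    (fun i (x : ∀ i, E i) => (s i).indicator (f i) (x i))
    (iIndepFun_pi (X := fun i => (s i).indicator (f i)) fun i => (hg i).aemeasurable)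
    fun i => (hg i).comp (measurable_pi_apply i)).trans ?_
  refine Finset.prod_congr rfl fun i _ => ?_
  refine ((measurePreserving_eval μ i).lintegral_comp (hg i)).trans ?_
  rw [lintegral_indicator (hs i), withDensity_apply _ (hs i)]

lemma map_withDensity_comp {α β : Type*} {mα : MeasurableSpace α} {mβ : MeasurableSpace β}
    (μ : Measure α) {X : α → β} (hX : Measurable X) {f : β → ℝ≥0∞} (hf : Measurable f) :
    (μ.withDensity fun a => f (X a)).map X = (μ.map X).withDensity f := by
  ext s hs
  rw [Measure.map_apply hX hs, withDensity_apply _ (hX hs), withDensity_apply _ hs,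
    setLIntegral_map hs hf hX]

/-- Exponential tilting shifts the mean of the standard normal distribution. -/
lemma gaussianReal_withDensity_exp (l : ℝ) :
    (gaussianReal 0 1).withDensity (fun x => ENNReal.ofReal (Real.exp (l * x - 1 / 2 * (l * l))))
      = gaussianReal l 1 := by
  rw [gaussianReal_of_var_ne_zero _ one_ne_zero, gaussianReal_of_var_ne_zero _ one_ne_zero,
    ← withDensity_mul _ (measurable_gaussianPDF 0 1) (by fun_prop)]
  congr 1
  ext x
  simp only [Pi.mul_apply, gaussianPDF]
  rw [← ENNReal.ofReal_mul (gaussianPDFReal_nonneg _ _ _), gaussianPDFReal, gaussianPDFReal,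
    mul_assoc, ← Real.exp_add]
  congr 3
  simp
  ring

lemma pi_gaussianReal_withDensity_exp {ι : Type*} [Fintype ι] (l : ι → ℝ) :
    (Measure.pi fun _ : ι => gaussianReal 0 1).withDensity
        (fun x => ENNReal.ofReal (Real.exp (l ⬝ᵥ x - 1 / 2 * (l ⬝ᵥ l))))
      = Measure.pi fun i => gaussianReal (l i) 1 := by
  have h := fun i => gaussianReal_withDensity_exp (l i)
  have : ∀ i, SigmaFinite ((gaussianReal 0 1).withDensity
      (fun x => ENNReal.ofReal (Real.exp (l i * x - 1 / 2 * (l i * l i))))) :=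
    fun i => by rw [h i]; infer_instance
  simp_rw [← h]
  rw [← withDensity_pi _ (fun i => by fun_prop)]
  congr 1
  ext x
  rw [← ENNReal.ofReal_prod_of_nonneg fun i _ => (Real.exp_pos _).le, ← Real.exp_sum,
    Finset.sum_sub_distrib, ← Finset.mul_sum]
  rfl

/-- A linear functional of a standard normal vector has the law of its length times a standard
normal variable. -/
lemma hasLaw_dotProduct {Ω : Type*} {mΩ : MeasurableSpace Ω} {P : Measure Ω} {ι : Type*}
    [Fintype ι] {X : Ω → ι → ℝ} (hX : HasLaw X (Measure.pi fun _ : ι => gaussianReal 0 1) P)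
    (c : ι → ℝ) :
    HasLaw (fun ω => c ⬝ᵥ X ω) ((gaussianReal 0 1).map fun x => √(c ⬝ᵥ c) * x) P := by
  have hc : 0 ≤ c ⬝ᵥ c := Finset.sum_nonneg fun i _ => mul_self_nonneg _
  have hL : HasLaw (fun x : ι → ℝ => c ⬝ᵥ x) ((gaussianReal 0 1).map fun x => √(c ⬝ᵥ c) * x)
      (Measure.pi fun _ : ι => gaussianReal 0 1) := by
    refine ⟨by fun_prop, ?_⟩
    have hev : ∀ i, HasLaw (fun x : ι → ℝ => c i * x i)
        (gaussianReal (c i * 0) (.mk (c i ^ 2) (sq_nonneg _) * 1))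
        (Measure.pi fun _ : ι => gaussianReal 0 1) := fun i =>
      gaussianReal_const_mul (measurePreserving_eval (fun _ : ι => gaussianReal 0 1) i).hasLaw _
    have hind : iIndepFun (fun i (x : ι → ℝ) => c i * x i)
        (Measure.pi fun _ : ι => gaussianReal 0 1) :=
      iIndepFun_pi (X := fun i (x : ℝ) => c i * x) fun i => by fun_prop
    have hmem : ∀ i, MemLp (fun x : ι → ℝ => c i * x i) 2
        (Measure.pi fun _ : ι => gaussianReal 0 1) := fun i =>
      ((memLp_id_gaussianReal' 2 (by simp)).comp_measurePreserving
        (measurePreserving_eval (fun _ : ι => gaussianReal 0 1) i)).const_mul (c i)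
    have hG : HasGaussianLaw (fun x : ι → ℝ => ∑ i, c i * x i)
        (Measure.pi fun _ : ι => gaussianReal 0 1) :=
      hind.hasGaussianLaw_fun_sum fun i => ⟨by rw [(hev i).map_eq]; infer_instance⟩
    have hmean : ∫ x, (∑ i, c i * x i) ∂(Measure.pi fun _ : ι => gaussianReal 0 1) = 0 := by
      rw [integral_finsetSum _ fun i _ => (hmem i).integrable (by simp)]
      refine Finset.sum_eq_zero fun i _ => ?_
      rw [(hev i).integral_eq]
      simp
    have hvar : Var[fun x : ι → ℝ => ∑ i, c i * x i; Measure.pi fun _ : ι => gaussianReal 0 1]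
        = c ⬝ᵥ c := by
      have := IndepFun.variance_sum (s := Finset.univ) (X := fun i (x : ι → ℝ) => c i * x i)
        (fun i _ => hmem i) (fun i _ j _ hij => hind.indepFun hij)
      rw [show (fun x : ι → ℝ => ∑ i, c i * x i) = ∑ i, fun x : ι → ℝ => c i * x i by ext; simp,
        this]
      refine Finset.sum_congr rfl fun i _ => ?_
      rw [(hev i).variance_eq]
      simp [sq]
    change Measure.map (fun x : ι → ℝ => ∑ i, c i * x i) _ = _
    rw [hG.map_eq_gaussianReal, hmean, hvar, gaussianReal_map_const_mul]
    congr 1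
    · simp
    · ext; simp [Real.sq_sqrt hc, hc]
  exact hL.comp hX

/-! ### Conditional laws -/

lemma condDistrib_add_of_indepFun {Ω β : Type*} {mΩ : MeasurableSpace Ω} {mβ : MeasurableSpace β}
    {P : Measure Ω} [IsProbabilityMeasure P] {X : Ω → β} {Z : β → ℝ} {W Y : Ω → ℝ}
    (hX : Measurable X) (hZ : Measurable Z) (hW : Measurable W) (hind : IndepFun X W P)
    (hY : Y =ᵐ[P] fun ω => Z (X ω) + W ω) :
    ∀ᵐ b ∂P.map X, condDistrib Y X P b = (P.map W).map (fun x => Z b + x) := by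
  have : IsProbabilityMeasure (P.map W) := Measure.isProbabilityMeasure_map hW.aemeasurable
  have hF : Measurable fun p : β × ℝ => Z p.1 + p.2 := by fun_prop
  let κ : Kernel β ℝ := (Kernel.id ×ₖ Kernel.const β (P.map W)).map fun p => Z p.1 + p.2
  have hκ : ∀ b, κ b = (P.map W).map fun x => Z b + x := by
    intro b
    rw [Kernel.map_apply _ hF, Kernel.prod_apply, Kernel.id_apply, Kernel.const_apply,
      Measure.dirac_prod, Measure.map_map hF (by fun_prop)]
    rfl
  have hYm : AEMeasurable Y P := AEMeasurable.congr (by fun_prop) hY.symm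
  have hcomp : P.map (fun ω => (X ω, Y ω)) = P.map X ⊗ₘ κ := by
    have h1 : P.map (fun ω => (X ω, Y ω)) = P.map (fun ω => (X ω, Z (X ω) + W ω)) :=
      Measure.map_congr (by filter_upwards [hY] with ω h; rw [h])
    have h2 : P.map (fun ω => (X ω, Z (X ω) + W ω))
        = ((P.map X).prod (P.map W)).map fun p => (p.1, Z p.1 + p.2) := by
      rw [← (indepFun_iff_map_prod_eq_prod_map_map hX.aemeasurable hW.aemeasurable).1 hind,
        Measure.map_map (by fun_prop) (by fun_prop)]
      rfl
    rw [h1, h2]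
    ext s hs
    rw [Measure.map_apply (by fun_prop) hs, Measure.compProd_apply hs,
      Measure.prod_apply (hs.preimage (by fun_prop))]
    refine lintegral_congr fun b => ?_
    rw [hκ, Measure.map_apply (by fun_prop) (hs.preimage (by fun_prop))]
    rfl
  filter_upwards [condDistrib_ae_eq_of_measure_eq_compProd X hYm hcomp] with b hb
  rw [hb, hκ]

/-- The conditional law given `m` of `Z + W`, with `Z` measurable for `m` and `W` independent of
`m`, is the law of `W` translated by `Z`. -/
lemma condLaw_add_of_indep {Ω : Type*} {m mΩ : MeasurableSpace Ω} {P : Measure Ω}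
    [IsProbabilityMeasure P] (hm : m ≤ mΩ) {Z W Y : Ω → ℝ}
    (hZ : Measurable[m] Z) (hW : Measurable W)
    (hind : Indep m (MeasurableSpace.comap W inferInstance) P)
    (hY : Y =ᵐ[P] fun ω => Z ω + W ω) :
    ∀ᵐ ω ∂P, condLaw P m Y ω = (P.map W).map (fun x => Z ω + x) := by
  -- conditioning on `m` is conditioning on the identity, as a map from `(Ω, mΩ)` to `(Ω, m)`
  have hid : @Measurable Ω Ω mΩ m id := measurable_id'' hm
  have hind' : @IndepFun Ω Ω ℝ mΩ m _ id W P := by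
    refine (@IndepFun_iff_Indep Ω Ω ℝ mΩ m _ id W P).2 ?_
    rwa [MeasurableSpace.comap_id]
  have key := @condDistrib_add_of_indepFun Ω Ω mΩ m P _ id Z W Y hid hZ hW hind' hY
  exact @ae_of_ae_map Ω Ω mΩ m P id (@Measurable.aemeasurable Ω Ω mΩ m id P hid) _ key

/-! ### Auxiliary facts on matrices and sums -/

lemma measurable_mulVec_const {Ω : Type*} {n : ℕ} {m : MeasurableSpace Ω}
    (B : Matrix (Fin n) (Fin n) ℝ) {f : Ω → Fin n → ℝ} (hf : Measurable[m] f) :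
    Measurable[m] fun ω => B *ᵥ f ω := by
  have : Measurable fun x : Fin n → ℝ => B *ᵥ x := by
    refine measurable_pi_iff.2 fun i => ?_
    change Measurable fun x : Fin n → ℝ => B i ⬝ᵥ x
    fun_prop
  exact this.comp hf

lemma sum_Icc_eq_add_sum_Icc_succ {E : Type*} [AddCommMonoid E] {a b : ℕ} (h : a ≤ b)
    (f : ℕ → E) : ∑ u ∈ Finset.Icc a b, f u = f a + ∑ u ∈ Finset.Icc (a + 1) b, f u := by
  rw [← Finset.insert_Icc_add_one_left_eq_Icc h, Finset.sum_insert (by simp)]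

namespace GaussianModel

variable {Ω : Type*} [mΩ : MeasurableSpace Ω] {P : Measure Ω} {T n : ℕ}

/-! ### The filtration -/

lemma measurable_eps_comap (𝓜 : GaussianModel P T n) {s t : ℕ} (hs : s ∈ Finset.Icc 1 t) :
    Measurable[⨆ r ∈ Finset.Icc 1 t, MeasurableSpace.comap (𝓜.ε r) inferInstance] (𝓜.ε s) := by
  refine Measurable.of_comap_le ?_
  exact le_iSup₂_of_le (f := fun r (_ : r ∈ Finset.Icc 1 t) =>
    MeasurableSpace.comap (𝓜.ε r) inferInstance) s hs le_rfl

/-- As the matrices `B_{t,t}` are invertible, `ε_t` can be recovered from `G_t` and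
`ε_1, …, ε_{t-1}`, so that both sequences generate the same filtration. -/
lemma filt_eq_iSup_comap_eps (𝓜 : GaussianModel P T n) {t : ℕ} (ht : t ≤ T) :
    𝓜.filt t = ⨆ s ∈ Finset.Icc 1 t, MeasurableSpace.comap (𝓜.ε s) inferInstance := by
  refine le_antisymm (iSup₂_le fun s hs => ?_) (iSup₂_le fun s hs => ?_)
  · rw [Finset.mem_Icc] at hs
    refine Measurable.comap_le (measurable_const.add ?_)
    refine Finset.measurable_fun_sum _ fun r hr => measurable_mulVec_const _
      (𝓜.measurable_eps_comap ?_)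
    rw [Finset.mem_Icc] at hr ⊢
    exact ⟨hr.1, hr.2.trans hs.2⟩
  · refine Measurable.comap_le ?_
    induction s using Nat.strong_induction_on with
    | _ s ih =>
      rw [Finset.mem_Icc] at hs
      have hG : Measurable[𝓜.filt t] (𝓜.G s) := Measurable.of_comap_le <|
        le_iSup₂_of_le (f := fun r (_ : r ∈ Finset.Icc 1 t) =>
          MeasurableSpace.comap (𝓜.G r) inferInstance) s (Finset.mem_Icc.2 hs) le_rfl
      have hdet : IsUnit (𝓜.B s s).det :=
        (𝓜.det_B_ne_zero s (Finset.mem_Icc.2 ⟨hs.1, hs.2.trans ht⟩)).isUnit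
      have heq : 𝓜.ε s = fun ω => (𝓜.B s s)⁻¹ *ᵥ (𝓜.G s ω -
          (𝓜.A s + ∑ r ∈ Finset.Icc 1 (s - 1), 𝓜.B s r *ᵥ 𝓜.ε r ω)) := by
        ext1 ω
        obtain ⟨k, rfl⟩ : ∃ k, s = k + 1 := ⟨s - 1, by omega⟩
        rw [G, Finset.sum_Icc_succ_top (by omega), Nat.add_sub_cancel, ← add_assoc,
          add_sub_cancel_left, mulVec_mulVec, Matrix.nonsing_inv_mul _ hdet, one_mulVec]
      rw [heq]
      refine measurable_mulVec_const _ (hG.sub (measurable_const.add ?_))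
      refine Finset.measurable_fun_sum _ fun r hr => measurable_mulVec_const _ ?_
      rw [Finset.mem_Icc] at hr
      exact ih r (by omega) (Finset.mem_Icc.2 ⟨hr.1, by omega⟩)

lemma filt_le (𝓜 : GaussianModel P T n) {t : ℕ} (ht : t ≤ T) : 𝓜.filt t ≤ mΩ := by
  rw [𝓜.filt_eq_iSup_comap_eps ht]
  refine iSup₂_le fun s hs => (𝓜.measurable_ε s ?_).comap_le
  rw [Finset.mem_Icc] at hs ⊢
  exact ⟨hs.1, hs.2.trans ht⟩

lemma measurable_eps_filt (𝓜 : GaussianModel P T n) {s t : ℕ} (ht : t ≤ T)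
    (hs : s ∈ Finset.Icc 1 t) : Measurable[𝓜.filt t] (𝓜.ε s) := by
  rw [𝓜.filt_eq_iSup_comap_eps ht]
  exact 𝓜.measurable_eps_comap hs

/-- The past `𝒢_t` is independent of the future innovations `ε_{t+1}, …, ε_T`. -/
lemma indep_filt_future (𝓜 : GaussianModel P T n) {t : ℕ} (ht : t ≤ T) :
    Indep (𝓜.filt t)
      (⨆ s ∈ Finset.Icc (t + 1) T, MeasurableSpace.comap (𝓜.ε s) inferInstance) P := by
  have h := indep_iSup_of_disjoint
    (m := fun i : Finset.Icc 1 T => MeasurableSpace.comap (𝓜.ε i) inferInstance)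
    (fun i => (𝓜.measurable_ε i i.2).comap_le) 𝓜.iIndepFun_ε.iIndep
    (S := {i | (i : ℕ) ≤ t}) (T := {i | t < (i : ℕ)})
    (Set.disjoint_left.2 fun i hi hi' => lt_irrefl t (lt_of_lt_of_le hi' hi))
  refine indep_of_indep_of_le_left (indep_of_indep_of_le_right h ?_) ?_
  · refine iSup₂_le fun s hs => ?_
    rw [Finset.mem_Icc] at hs
    exact le_iSup₂_of_le (f := fun (i : Finset.Icc 1 T) (_ : i ∈ {i : Finset.Icc 1 T | t < i}) =>
      MeasurableSpace.comap (𝓜.ε i) inferInstance)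
      ⟨s, Finset.mem_Icc.2 ⟨by omega, hs.2⟩⟩ hs.1 le_rfl
  · rw [𝓜.filt_eq_iSup_comap_eps ht]
    refine iSup₂_le fun s hs => ?_
    rw [Finset.mem_Icc] at hs
    exact le_iSup₂_of_le (f := fun (i : Finset.Icc 1 T) (_ : i ∈ {i : Finset.Icc 1 T | ↑i ≤ t}) =>
      MeasurableSpace.comap (𝓜.ε i) inferInstance)
      ⟨s, Finset.mem_Icc.2 ⟨hs.1, by omega⟩⟩ hs.2 le_rfl

lemma mem_Icc_one_of_future {s t : ℕ} (hs : s ∈ Finset.Icc (t + 1) T) : s ∈ Finset.Icc 1 T := by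
  rw [Finset.mem_Icc] at hs ⊢
  exact ⟨by omega, hs.2⟩

lemma measurable_eps_future (𝓜 : GaussianModel P T n) {s t : ℕ}
    (hs : s ∈ Finset.Icc (t + 1) T) :
    Measurable[⨆ s ∈ Finset.Icc (t + 1) T, MeasurableSpace.comap (𝓜.ε s) inferInstance] (𝓜.ε s) :=
  Measurable.of_comap_le <| le_iSup₂_of_le (f := fun r (_ : r ∈ Finset.Icc (t + 1) T) =>
    MeasurableSpace.comap (𝓜.ε r) inferInstance) s hs le_rfl

lemma future_le (𝓜 : GaussianModel P T n) (t : ℕ) :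
    ⨆ s ∈ Finset.Icc (t + 1) T, MeasurableSpace.comap (𝓜.ε s) inferInstance ≤ mΩ := by
  exact iSup₂_le fun s hs => (𝓜.measurable_ε s (mem_Icc_one_of_future hs)).comap_le

/-! ### Linear functionals of the innovations -/

lemma hasLaw_dot_eps (𝓜 : GaussianModel P T n) (c : Fin n → ℝ) {s : ℕ}
    (hs : s ∈ Finset.Icc 1 T) :
    HasLaw (fun ω => c ⬝ᵥ 𝓜.ε s ω) ((gaussianReal 0 1).map fun x => √(c ⬝ᵥ c) * x) P :=
  hasLaw_dotProduct (𝓜.hasLaw_ε s hs) c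

lemma memLp_dot_eps (𝓜 : GaussianModel P T n) (c : Fin n → ℝ) {s : ℕ}
    (hs : s ∈ Finset.Icc 1 T) {p : ℝ≥0∞} (hp : p ≠ ∞) :
    MemLp (fun ω => c ⬝ᵥ 𝓜.ε s ω) p P := by
  have h := 𝓜.hasLaw_dot_eps c hs
  have h1 : MemLp id p (P.map fun ω => c ⬝ᵥ 𝓜.ε s ω) := by
    rw [h.map_eq, gaussianReal_map_const_mul]
    exact memLp_id_gaussianReal' p hp
  exact h1.comp_of_map h.aemeasurable

lemma integral_dot_eps (𝓜 : GaussianModel P T n) (c : Fin n → ℝ) {s : ℕ}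
    (hs : s ∈ Finset.Icc 1 T) : ∫ ω, c ⬝ᵥ 𝓜.ε s ω ∂P = 0 := by
  rw [(𝓜.hasLaw_dot_eps c hs).integral_eq, gaussianReal_map_const_mul, integral_id_gaussianReal]
  simp

lemma variance_dot_eps (𝓜 : GaussianModel P T n) (c : Fin n → ℝ) {s : ℕ}
    (hs : s ∈ Finset.Icc 1 T) : Var[fun ω => c ⬝ᵥ 𝓜.ε s ω; P] = c ⬝ᵥ c := by
  have hc : 0 ≤ c ⬝ᵥ c := Finset.sum_nonneg fun i _ => mul_self_nonneg _
  rw [(𝓜.hasLaw_dot_eps c hs).variance_eq, gaussianReal_map_const_mul, variance_id_gaussianReal]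
  simp [Real.sq_sqrt hc]

lemma variance_sum_dot_eps (𝓜 : GaussianModel P T n) (c : ℕ → Fin n → ℝ) (t : ℕ) :
    Var[fun ω => ∑ s ∈ Finset.Icc (t + 1) T, c s ⬝ᵥ 𝓜.ε s ω; P]
      = ∑ s ∈ Finset.Icc (t + 1) T, c s ⬝ᵥ c s := by
  have h := IndepFun.variance_sum (μ := P) (s := Finset.Icc (t + 1) T)
    (X := fun s ω => c s ⬝ᵥ 𝓜.ε s ω)
    (fun s hs => 𝓜.memLp_dot_eps (c s) (mem_Icc_one_of_future hs) (by simp)) (fun r hr s hs hrs => by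
      have hi := 𝓜.iIndepFun_ε.indepFun (i := ⟨r, mem_Icc_one_of_future hr⟩) (j := ⟨s, mem_Icc_one_of_future hs⟩)
        (by simpa using hrs)
      exact hi.comp (φ := fun x => c r ⬝ᵥ x) (ψ := fun x => c s ⬝ᵥ x)
        (by fun_prop) (by fun_prop))
  rw [show (fun ω => ∑ s ∈ Finset.Icc (t + 1) T, c s ⬝ᵥ 𝓜.ε s ω)
    = ∑ s ∈ Finset.Icc (t + 1) T, fun ω => c s ⬝ᵥ 𝓜.ε s ω by ext; simp, h]
  exact Finset.sum_congr rfl fun s hs => 𝓜.variance_dot_eps _ (mem_Icc_one_of_future hs)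

lemma measurable_future_sum (𝓜 : GaussianModel P T n) (c : ℕ → Fin n → ℝ) (t : ℕ) :
    Measurable[⨆ s ∈ Finset.Icc (t + 1) T, MeasurableSpace.comap (𝓜.ε s) inferInstance]
      fun ω => ∑ s ∈ Finset.Icc (t + 1) T, c s ⬝ᵥ 𝓜.ε s ω := by
  refine Finset.measurable_fun_sum _ fun s hs => ?_
  have : Measurable fun x : Fin n → ℝ => c s ⬝ᵥ x := by fun_prop
  exact this.comp (𝓜.measurable_eps_future hs)

lemma integrable_future_sum [IsFiniteMeasure P] (𝓜 : GaussianModel P T n) (c : ℕ → Fin n → ℝ)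
    (t : ℕ) : Integrable (fun ω => ∑ s ∈ Finset.Icc (t + 1) T, c s ⬝ᵥ 𝓜.ε s ω) P :=
  integrable_finsetSum _ fun s hs =>
    (𝓜.memLp_dot_eps (c s) (mem_Icc_one_of_future hs) ENNReal.one_ne_top).integrable le_rfl

lemma integral_future_sum [IsFiniteMeasure P] (𝓜 : GaussianModel P T n) (c : ℕ → Fin n → ℝ)
    (t : ℕ) : ∫ ω, ∑ s ∈ Finset.Icc (t + 1) T, c s ⬝ᵥ 𝓜.ε s ω ∂P = 0 := by
  rw [integral_finsetSum _ fun s hs =>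
    (𝓜.memLp_dot_eps (c s) (mem_Icc_one_of_future hs) ENNReal.one_ne_top).integrable le_rfl]
  exact Finset.sum_eq_zero fun s hs => 𝓜.integral_dot_eps _ (mem_Icc_one_of_future hs)

/-- The affine functional `a + ∑_{s=1}^t c_sᵀ ε_s` of the innovations up to time `t`. -/
def affine (𝓜 : GaussianModel P T n) (a : ℝ) (c : ℕ → Fin n → ℝ) (t : ℕ) (ω : Ω) : ℝ :=
  a + ∑ s ∈ Finset.Icc 1 t, c s ⬝ᵥ 𝓜.ε s ω

lemma measurable_affine (𝓜 : GaussianModel P T n) (a : ℝ) (c : ℕ → Fin n → ℝ) {t : ℕ}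
    (ht : t ≤ T) : Measurable[𝓜.filt t] (𝓜.affine a c t) := by
  refine measurable_const.add (Finset.measurable_fun_sum _ fun s hs => ?_)
  have : Measurable fun x : Fin n → ℝ => c s ⬝ᵥ x := by fun_prop
  exact this.comp (𝓜.measurable_eps_filt ht hs)

lemma memLp_affine [IsFiniteMeasure P] (𝓜 : GaussianModel P T n) (a : ℝ) (c : ℕ → Fin n → ℝ)
    {t : ℕ} (ht : t ≤ T) {p : ℝ≥0∞} (hp : p ≠ ∞) : MemLp (𝓜.affine a c t) p P := by
  refine (memLp_const a).add (memLp_finsetSum _ fun s hs => 𝓜.memLp_dot_eps (c s) ?_ hp)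
  rw [Finset.mem_Icc] at hs ⊢
  exact ⟨hs.1, hs.2.trans ht⟩

lemma affine_eq_add_future (𝓜 : GaussianModel P T n) (a : ℝ) (c : ℕ → Fin n → ℝ) {t r : ℕ}
    (htr : t ≤ r) (ω : Ω) :
    𝓜.affine a c r ω = 𝓜.affine a c t ω + ∑ s ∈ Finset.Icc (t + 1) r, c s ⬝ᵥ 𝓜.ε s ω := by
  have h : ∀ k, Finset.Icc 1 k = Finset.Ioc 0 k := fun k => by ext; simp [Nat.succ_le_iff]
  have h' : Finset.Icc (t + 1) r = Finset.Ioc t r := by ext; simp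
  rw [affine, affine, h, h, h', add_assoc, Finset.sum_Ioc_consecutive _ (Nat.zero_le t) htr]

lemma condExp_affine [IsProbabilityMeasure P] (𝓜 : GaussianModel P T n) (a : ℝ)
    (c : ℕ → Fin n → ℝ) {t : ℕ} (ht : t ≤ T) :
    P[𝓜.affine a c T | 𝓜.filt t] =ᵐ[P] 𝓜.affine a c t := by
  have hle := 𝓜.filt_le ht
  let F : Ω → ℝ := fun ω => ∑ s ∈ Finset.Icc (t + 1) T, c s ⬝ᵥ 𝓜.ε s ω
  have hdec : 𝓜.affine a c T = 𝓜.affine a c t + F := funext (𝓜.affine_eq_add_future a c ht)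
  have hL : Integrable (𝓜.affine a c t) P :=
    (𝓜.memLp_affine a c ht ENNReal.one_ne_top).integrable le_rfl
  have h1 := condExp_indep_eq (𝓜.future_le t) hle (𝓜.measurable_future_sum c t).stronglyMeasurable
    (𝓜.indep_filt_future ht).symm
  rw [hdec]
  filter_upwards [condExp_add hL (𝓜.integrable_future_sum c t) (𝓜.filt t), h1] with ω h h1
  rw [h, Pi.add_apply, h1, 𝓜.integral_future_sum, add_zero, condExp_of_stronglyMeasurable hle
    (𝓜.measurable_affine a c ht).stronglyMeasurable hL]

lemma condVar_affine [IsProbabilityMeasure P] (𝓜 : GaussianModel P T n) (a : ℝ)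
    (c : ℕ → Fin n → ℝ) {t : ℕ} (ht : t ≤ T) :
    condVar (𝓜.filt t) (𝓜.affine a c T) P
      =ᵐ[P] fun _ => ∑ s ∈ Finset.Icc (t + 1) T, c s ⬝ᵥ c s := by
  let F : Ω → ℝ := fun ω => ∑ s ∈ Finset.Icc (t + 1) T, c s ⬝ᵥ 𝓜.ε s ω
  have hsq : (𝓜.affine a c T - P[𝓜.affine a c T | 𝓜.filt t]) ^ 2 =ᵐ[P] F ^ 2 := by
    filter_upwards [𝓜.condExp_affine a c ht] with ω h
    simp only [Pi.pow_apply, Pi.sub_apply, h]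
    rw [𝓜.affine_eq_add_future a c ht, add_sub_cancel_left]
  have h1 := condExp_indep_eq (𝓜.future_le t) (𝓜.filt_le ht) ((𝓜.measurable_future_sum c t).pow_const 2).stronglyMeasurable
    (𝓜.indep_filt_future ht).symm
  have h2 := variance_of_integral_eq_zero
    ((𝓜.measurable_future_sum c t).mono (𝓜.future_le t) le_rfl).aemeasurable
    (𝓜.integral_future_sum c t)
  refine (condExp_congr_ae hsq).trans (h1.trans (Filter.Eventually.of_forall fun ω => ?_))
  exact h2.symm.trans (𝓜.variance_sum_dot_eps c t)

/-! ### Change of measure -/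

/-- The joint law of the innovations under `Q`: independent normal vectors with means `λ_s`. -/
lemma map_eps_Q [IsProbabilityMeasure P] (𝓜 : GaussianModel P T n) :
    𝓜.Q.map (fun ω (s : Finset.Icc 1 T) => 𝓜.ε s ω)
      = Measure.pi fun s : Finset.Icc 1 T => Measure.pi fun i => gaussianReal (𝓜.lam s i) 1 := by
  have hm : ∀ s : Finset.Icc 1 T, Measurable (𝓜.ε s) := fun s => 𝓜.measurable_ε s s.2
  let f : Finset.Icc 1 T → (Fin n → ℝ) → ℝ≥0∞ := fun s x =>
    ENNReal.ofReal (Real.exp (𝓜.lam s ⬝ᵥ x - 1 / 2 * (𝓜.lam s ⬝ᵥ 𝓜.lam s)))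
  have hf : ∀ s, Measurable (f s) := fun s => by fun_prop
  have hQ : 𝓜.Q = P.withDensity fun ω => ∏ s : Finset.Icc 1 T, f s (𝓜.ε s ω) := by
    rw [Q]
    congr 1
    ext ω
    rw [D, Real.exp_sum, ENNReal.ofReal_prod_of_nonneg fun i _ => (Real.exp_pos _).le,
      ← Finset.prod_coe_sort]
  have hlaw : P.map (fun ω (s : Finset.Icc 1 T) => 𝓜.ε s ω)
      = Measure.pi fun _ : Finset.Icc 1 T => Measure.pi fun _ : Fin n => gaussianReal 0 1 := by
    rw [(iIndepFun_iff_map_fun_eq_pi_map fun s => (hm s).aemeasurable).1 𝓜.iIndepFun_ε]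
    congr 1
    ext1 s
    exact (𝓜.hasLaw_ε s s.2).map_eq
  have htilt : ∀ s, (Measure.pi fun _ : Fin n => gaussianReal 0 1).withDensity (f s)
      = Measure.pi fun i => gaussianReal (𝓜.lam s i) 1 :=
    fun s => pi_gaussianReal_withDensity_exp (𝓜.lam s)
  have : ∀ s, SigmaFinite ((Measure.pi fun _ : Fin n => gaussianReal 0 1).withDensity (f s)) :=
    fun s => by rw [htilt s]; infer_instance
  rw [hQ, map_withDensity_comp P (X := fun ω (s : Finset.Icc 1 T) => 𝓜.ε s ω)
    (f := fun x => ∏ s, f s (x s)) (measurable_pi_lambda _ hm)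
    (Finset.measurable_fun_prod _ fun s _ => (hf s).comp (measurable_pi_apply s)), hlaw,
    withDensity_pi _ hf]
  simp_rw [htilt]

lemma isProbabilityMeasure_Q [IsProbabilityMeasure P] (𝓜 : GaussianModel P T n) :
    IsProbabilityMeasure 𝓜.Q := by
  have hm : Measurable fun ω (s : Finset.Icc 1 T) => 𝓜.ε s ω :=
    measurable_pi_lambda _ fun s => 𝓜.measurable_ε s s.2
  have h : 𝓜.Q.map (fun ω (s : Finset.Icc 1 T) => 𝓜.ε s ω) univ = 1 := by
    rw [𝓜.map_eps_Q, measure_univ]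
  rw [Measure.map_apply hm MeasurableSet.univ] at h
  exact ⟨h⟩

/-- Girsanov's theorem for the model: under `Q`, the vectors `ε_s - λ_s` are independent standard
normal, and they drive the same process `G` with the same matrices `B` and a shifted `A`. -/
def shifted [IsProbabilityMeasure P] (𝓜 : GaussianModel P T n) : GaussianModel 𝓜.Q T n where
  ε t ω := 𝓜.ε t ω - 𝓜.lam t
  A t := 𝓜.A t + ∑ s ∈ Finset.Icc 1 t, 𝓜.B t s *ᵥ 𝓜.lam s
  B := 𝓜.B
  lam := 𝓜.lam
  measurable_ε t ht := (𝓜.measurable_ε t ht).sub_const _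
  hasLaw_ε t ht := by
    have hm : Measurable fun ω (s : Finset.Icc 1 T) => 𝓜.ε s ω :=
      measurable_pi_lambda _ fun s => 𝓜.measurable_ε s s.2
    refine ⟨((𝓜.measurable_ε t ht).sub_const _).aemeasurable, ?_⟩
    have h1 : 𝓜.Q.map (𝓜.ε t) = Measure.pi fun i => gaussianReal (𝓜.lam t i) 1 := by
      rw [← (measurePreserving_eval (fun s : Finset.Icc 1 T => Measure.pi fun i =>
        gaussianReal (𝓜.lam s i) 1) ⟨t, ht⟩).map_eq, ← 𝓜.map_eps_Q,
        Measure.map_map (measurable_pi_apply _) hm]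
      rfl
    have h2 : 𝓜.Q.map (fun ω => 𝓜.ε t ω - 𝓜.lam t)
        = (𝓜.Q.map (𝓜.ε t)).map fun x i => x i - 𝓜.lam t i := by
      rw [Measure.map_map (by fun_prop) (𝓜.measurable_ε t ht)]
      rfl
    rw [h2, h1, Measure.pi_map_pi (f := fun i x => x - 𝓜.lam t i) fun i => by fun_prop]
    simp_rw [gaussianReal_map_sub_const, sub_self]
  iIndepFun_ε := by
    have hm : ∀ s : Finset.Icc 1 T, Measurable (𝓜.ε s) := fun s => 𝓜.measurable_ε s s.2
    have := 𝓜.isProbabilityMeasure_Q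
    have hi : iIndepFun (fun s : Finset.Icc 1 T => 𝓜.ε s) 𝓜.Q := by
      rw [iIndepFun_iff_map_fun_eq_pi_map fun s => (hm s).aemeasurable, 𝓜.map_eps_Q]
      congr 1
      ext1 t
      rw [← (measurePreserving_eval (fun s : Finset.Icc 1 T => Measure.pi fun i =>
        gaussianReal (𝓜.lam s i) 1) t).map_eq, ← 𝓜.map_eps_Q,
        Measure.map_map (measurable_pi_apply _) (measurable_pi_lambda _ hm)]
      rfl
    exact hi.comp (fun s x => x - 𝓜.lam s) fun s => by fun_prop
  det_B_ne_zero := 𝓜.det_B_ne_zero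

lemma shifted_G [IsProbabilityMeasure P] (𝓜 : GaussianModel P T n) : 𝓜.shifted.G = 𝓜.G := by
  ext1 t
  ext1 ω
  simp only [G, shifted, mulVec_sub, Finset.sum_sub_distrib]
  abel

lemma shifted_filt [IsProbabilityMeasure P] (𝓜 : GaussianModel P T n) (t : ℕ) :
    𝓜.shifted.filt t = 𝓜.filt t := by
  rw [filt, filt, shifted_G]

lemma shifted_X [IsProbabilityMeasure P] (𝓜 : GaussianModel P T n) (g : ℕ → Fin n → ℝ) :
    𝓜.shifted.X g = 𝓜.X g := by
  ext t ω
  rw [X, X, shifted_G]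

lemma Q_absolutelyContinuous (𝓜 : GaussianModel P T n) : 𝓜.Q ≪ P :=
  withDensity_absolutelyContinuous _ _

lemma measurable_D (𝓜 : GaussianModel P T n) : Measurable (𝓜.D T) := by
  refine Real.measurable_exp.comp (Finset.measurable_fun_sum _ fun s hs => ?_)
  have : Measurable fun x : Fin n → ℝ => 𝓜.lam s ⬝ᵥ x - 1 / 2 * (𝓜.lam s ⬝ᵥ 𝓜.lam s) := by
    fun_prop
  exact this.comp (𝓜.measurable_ε s hs)

lemma absolutelyContinuous_Q (𝓜 : GaussianModel P T n) : P ≪ 𝓜.Q :=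
  withDensity_absolutelyContinuous' 𝓜.measurable_D.ennreal_ofReal.aemeasurable
    (Filter.Eventually.of_forall fun _ => (ENNReal.ofReal_pos.2 (Real.exp_pos _)).ne')

/-! ### Loadings of the cash flows on the innovations -/

/-- The loading of `X_u` on `ε_r`: the vector `B_{u,r}ᵀ g_u` for `r ≤ u`. It is extended by zero
to `r > u`, so that cash flows at different times can be added over a common range. -/
def load (𝓜 : GaussianModel P T n) (g : ℕ → Fin n → ℝ) (u r : ℕ) : Fin n → ℝ :=
  if r ≤ u then (𝓜.B u r)ᵀ *ᵥ g u else 0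

/-- The nonrandom part of `∑_{u=t}^T X_u`. -/
def tailMean (𝓜 : GaussianModel P T n) (g : ℕ → Fin n → ℝ) (t : ℕ) : ℝ :=
  ∑ u ∈ Finset.Icc t T, g u ⬝ᵥ 𝓜.A u

/-- The loading of `∑_{u=t}^T X_u` on `ε_r`. -/
def tailLoad (𝓜 : GaussianModel P T n) (g : ℕ → Fin n → ℝ) (t r : ℕ) : Fin n → ℝ :=
  ∑ u ∈ Finset.Icc t T, 𝓜.load g u r

lemma X_eq_affine (𝓜 : GaussianModel P T n) (g : ℕ → Fin n → ℝ) {u t : ℕ} (hut : u ≤ t) :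
    𝓜.X g u = 𝓜.affine (g u ⬝ᵥ 𝓜.A u) (𝓜.load g u) t := by
  ext1 ω
  have h : ∑ s ∈ Finset.Icc 1 t, 𝓜.load g u s ⬝ᵥ 𝓜.ε s ω
      = ∑ s ∈ Finset.Icc 1 u, 𝓜.load g u s ⬝ᵥ 𝓜.ε s ω := by
    refine (Finset.sum_subset (Finset.Icc_subset_Icc_right hut) fun s hs hs' => ?_).symm
    rw [Finset.mem_Icc] at hs hs'
    rw [load, if_neg (by omega), zero_dotProduct]
  rw [affine, h, X, G, dotProduct_add, dotProduct_sum]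
  congr 1
  refine Finset.sum_congr rfl fun s hs => ?_
  rw [load, if_pos (Finset.mem_Icc.1 hs).2, mulVec_transpose, dotProduct_mulVec]

lemma sum_affine (𝓜 : GaussianModel P T n) (S : Finset ℕ) (a : ℕ → ℝ) (c : ℕ → ℕ → Fin n → ℝ)
    (t : ℕ) (ω : Ω) :
    ∑ u ∈ S, 𝓜.affine (a u) (c u) t ω
      = 𝓜.affine (∑ u ∈ S, a u) (fun r => ∑ u ∈ S, c u r) t ω := by
  simp only [affine, Finset.sum_add_distrib, sum_dotProduct]
  rw [Finset.sum_comm]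

lemma sum_X_eq_affine (𝓜 : GaussianModel P T n) (g : ℕ → Fin n → ℝ) (t : ℕ) (ω : Ω) :
    ∑ u ∈ Finset.Icc t T, 𝓜.X g u ω = 𝓜.affine (𝓜.tailMean g t) (𝓜.tailLoad g t) T ω := by
  rw [show 𝓜.tailLoad g t = fun r => ∑ u ∈ Finset.Icc t T, 𝓜.load g u r from rfl, tailMean,
    ← sum_affine]
  exact Finset.sum_congr rfl fun u hu => by rw [𝓜.X_eq_affine g (Finset.mem_Icc.1 hu).2]

/-- With `H_t = E_t[∑_{u>t} X_u]`, the innovation of `X_{t+1} + H_{t+1}` over `H_t` is the part of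
`∑_{u>t} X_u` that loads on `ε_{t+1}`. -/
lemma X_add_affine_tail (𝓜 : GaussianModel P T n) (g : ℕ → Fin n → ℝ) {t : ℕ} (ht : t < T)
    (ω : Ω) :
    𝓜.X g (t + 1) ω + 𝓜.affine (𝓜.tailMean g (t + 2)) (𝓜.tailLoad g (t + 2)) (t + 1) ω
      = 𝓜.affine (𝓜.tailMean g (t + 1)) (𝓜.tailLoad g (t + 1)) t ω
        + 𝓜.tailLoad g (t + 1) (t + 1) ⬝ᵥ 𝓜.ε (t + 1) ω := by
  have h1 : 𝓜.affine (𝓜.tailMean g (t + 1)) (𝓜.tailLoad g (t + 1)) (t + 1) ω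
      = 𝓜.X g (t + 1) ω
        + 𝓜.affine (𝓜.tailMean g (t + 2)) (𝓜.tailLoad g (t + 2)) (t + 1) ω := by
    rw [𝓜.X_eq_affine g le_rfl]
    simp only [affine, tailMean, tailLoad, sum_Icc_eq_add_sum_Icc_succ (Nat.succ_le_of_lt ht), add_dotProduct, Finset.sum_add_distrib]
    ring
  rw [← h1, affine_eq_add_future _ _ _ (Nat.le_succ t)]
  simp

lemma tailLoad_eq_self (𝓜 : GaussianModel P T n) (g : ℕ → Fin n → ℝ) {t s : ℕ} (hts : t ≤ s) :
    𝓜.tailLoad g t s = 𝓜.tailLoad g s s := by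
  refine (Finset.sum_subset (Finset.Icc_subset_Icc_left hts) fun u hu hu' => ?_).symm
  rw [Finset.mem_Icc] at hu hu'
  rw [load, if_neg (by omega)]

lemma tailLoad_self (𝓜 : GaussianModel P T n) (g : ℕ → Fin n → ℝ) (s : ℕ) :
    𝓜.tailLoad g s s = ∑ u ∈ Finset.Icc s T, (𝓜.B u s)ᵀ *ᵥ g u :=
  Finset.sum_congr rfl fun u hu => by rw [load, if_pos (Finset.mem_Icc.1 hu).1]

lemma drift_eq (𝓜 : GaussianModel P T n) (g : ℕ → Fin n → ℝ) (s : ℕ) :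
    𝓜.drift g s = 𝓜.tailLoad g s s ⬝ᵥ 𝓜.lam s := by
  rw [drift, tailLoad_self, sum_dotProduct]
  exact Finset.sum_congr rfl fun u _ => by rw [mulVec_transpose, dotProduct_mulVec]

lemma sigmaSq_eq (𝓜 : GaussianModel P T n) (g : ℕ → Fin n → ℝ) (s : ℕ) :
    𝓜.sigmaSq g s = 𝓜.tailLoad g s s ⬝ᵥ 𝓜.tailLoad g s s := by
  rw [sigmaSq, tailLoad_self, sum_dotProduct]
  refine Finset.sum_congr rfl fun j _ => ?_
  rw [dotProduct_sum]
  refine Finset.sum_congr rfl fun k _ => ?_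
  rw [← mulVec_mulVec, dotProduct_mulVec, mulVec_transpose (𝓜.B j s)]

lemma sigmaSq_nonneg (𝓜 : GaussianModel P T n) (g : ℕ → Fin n → ℝ) (s : ℕ) :
    0 ≤ 𝓜.sigmaSq g s := by
  rw [sigmaSq_eq]
  exact Finset.sum_nonneg fun i _ => mul_self_nonneg _

lemma sigma_sq (𝓜 : GaussianModel P T n) (g : ℕ → Fin n → ℝ) (s : ℕ) :
    (𝓜.sigma g s) ^ 2 = 𝓜.sigmaSq g s :=
  Real.sq_sqrt (𝓜.sigmaSq_nonneg g s)

lemma sum_condExp_X [IsProbabilityMeasure P] (𝓜 : GaussianModel P T n) (g : ℕ → Fin n → ℝ)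
    {t : ℕ} (ht : t ≤ T) :
    (fun ω => ∑ s ∈ Finset.Icc (t + 1) T, (P[𝓜.X g s | 𝓜.filt t]) ω)
      =ᵐ[P] 𝓜.affine (𝓜.tailMean g (t + 1)) (𝓜.tailLoad g (t + 1)) t := by
  have hX : ∀ s ∈ Finset.Icc (t + 1) T, Integrable (𝓜.X g s) P := fun s hs => by
    rw [𝓜.X_eq_affine g (Finset.mem_Icc.1 hs).2]
    exact (𝓜.memLp_affine _ _ le_rfl ENNReal.one_ne_top).integrable le_rfl
  have h : ∑ s ∈ Finset.Icc (t + 1) T, 𝓜.X g s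
      = 𝓜.affine (𝓜.tailMean g (t + 1)) (𝓜.tailLoad g (t + 1)) T := by
    ext ω
    rw [Finset.sum_apply, sum_X_eq_affine]
  filter_upwards [condExp_finsetSum hX (𝓜.filt t), 𝓜.condExp_affine _ _ ht] with ω h1 h2
  rw [← h2, ← h, h1, Finset.sum_apply]

lemma affine_tail_shifted [IsProbabilityMeasure P] (𝓜 : GaussianModel P T n)
    (g : ℕ → Fin n → ℝ) {t : ℕ} (ht : t ≤ T) (ω : Ω) :
    𝓜.shifted.affine (𝓜.shifted.tailMean g (t + 1)) (𝓜.shifted.tailLoad g (t + 1)) t ω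
      = 𝓜.affine (𝓜.tailMean g (t + 1)) (𝓜.tailLoad g (t + 1)) t ω
        + ∑ s ∈ Finset.Icc (t + 1) T, 𝓜.drift g s := by
  -- `∑_{u>t} X_u` is the same random variable in both models; splitting it at time `t` and
  -- comparing the future parts gives the difference of the past parts
  have h1 := 𝓜.shifted.sum_X_eq_affine g (t + 1) ω
  have h2 := 𝓜.sum_X_eq_affine g (t + 1) ω
  rw [affine_eq_add_future _ _ _ ht] at h1 h2
  rw [shifted_X, h2] at h1
  have h3 : ∑ s ∈ Finset.Icc (t + 1) T, 𝓜.shifted.tailLoad g (t + 1) s ⬝ᵥ 𝓜.shifted.ε s ω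
      = ∑ s ∈ Finset.Icc (t + 1) T, 𝓜.tailLoad g (t + 1) s ⬝ᵥ 𝓜.ε s ω
        - ∑ s ∈ Finset.Icc (t + 1) T, 𝓜.drift g s := by
    rw [← Finset.sum_sub_distrib]
    refine Finset.sum_congr rfl fun s hs => ?_
    rw [drift_eq, ← 𝓜.tailLoad_eq_self g (Finset.mem_Icc.1 hs).1, ← dotProduct_sub]
    rfl
  rw [h3] at h1
  linarith

/-! ### One step of the valuation -/

section OneStep

variable [IsProbabilityMeasure P]

lemma condLaw_step (𝓜 : GaussianModel P T n) {t : ℕ} (ht : t < T) {Z Y : Ω → ℝ}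
    (hZ : Measurable[𝓜.filt t] Z) (w : Fin n → ℝ)
    (hY : Y =ᵐ[P] fun ω => Z ω + w ⬝ᵥ 𝓜.ε (t + 1) ω) :
    ∀ᵐ ω ∂P, condLaw P (𝓜.filt t) Y ω
      = (gaussianReal 0 1).map fun x => Z ω + √(w ⬝ᵥ w) * x := by
  have hmem : t + 1 ∈ Finset.Icc (t + 1) T := Finset.mem_Icc.2 ⟨le_rfl, ht⟩
  have hw : Measurable fun x : Fin n → ℝ => w ⬝ᵥ x := by fun_prop
  have hW := hw.comp (𝓜.measurable_eps_future hmem)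
  have h := condLaw_add_of_indep (𝓜.filt_le ht.le) (W := fun ω => w ⬝ᵥ 𝓜.ε (t + 1) ω) hZ
    (hW.mono (𝓜.future_le t) le_rfl)
    (indep_of_indep_of_le_right (𝓜.indep_filt_future ht.le) hW.comap_le) hY
  filter_upwards [h] with ω h
  rw [h, (𝓜.hasLaw_dot_eps w (mem_Icc_one_of_future hmem)).map_eq,
    Measure.map_map (by fun_prop) (by fun_prop)]
  rfl

lemma integrableOn_quantile_step (𝓜 : GaussianModel P T n) {M : Measure ℝ}
    (hM : IsQuantileWeight M) {t : ℕ} (ht : t < T) {Z Y : Ω → ℝ}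
    (hZ : Measurable[𝓜.filt t] Z) (w : Fin n → ℝ)
    (hY : Y =ᵐ[P] fun ω => Z ω + w ⬝ᵥ 𝓜.ε (t + 1) ω) :
    ∀ᵐ ω ∂P, IntegrableOn (quantile (condLaw P (𝓜.filt t) Y ω)) (Ioo 0 1) M := by
  filter_upwards [𝓜.condLaw_step ht hZ w hY] with ω h
  have := hM.isProbabilityMeasure
  have hint : IntegrableOn (fun u => Z ω + √(w ⬝ᵥ w) * stdNormalQuantile u) (Ioo 0 1) M :=
    (integrable_const _).add ((integrableOn_stdNormalQuantile hM).const_mul _)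
  rw [h]
  exact hint.congr_fun (fun u hu => (quantile_map_affine (Z ω) (Real.sqrt_nonneg _) hu).symm)
    measurableSet_Ioo

lemma rho_step (𝓜 : GaussianModel P T n) {M : Measure ℝ}
    (hM : IsQuantileWeight M) {t : ℕ} (ht : t < T) {Z Y : Ω → ℝ}
    (hZ : Measurable[𝓜.filt t] Z) (w : Fin n → ℝ)
    (hY : Y =ᵐ[P] fun ω => Z ω + w ⬝ᵥ 𝓜.ε (t + 1) ω) :
    𝓜.rho M t (-Y) =ᵐ[P] fun ω => Z ω + √(w ⬝ᵥ w) * rZero M := by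
  have := hM.isProbabilityMeasure
  filter_upwards [𝓜.condLaw_step ht hZ w hY] with ω h
  have h1 : M (Ioo 0 1) = 1 := (prob_compl_eq_zero_iff measurableSet_Ioo).1 hM.compl_Ioo
  rw [rho, riskMeasure, neg_neg, h, setIntegral_congr_fun measurableSet_Ioo fun u hu =>
    quantile_map_affine (Z ω) (Real.sqrt_nonneg _) hu]
  change ∫ u in Ioo 0 1, (Z ω + √(w ⬝ᵥ w) * stdNormalQuantile u) ∂M = _
  rw [integral_add (integrable_const _) ((integrableOn_stdNormalQuantile hM).const_mul _),
    integral_const_mul, rZero]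
  simp [measureReal_def, h1]

/-- The put option in the recursion depends on `ε_{t+1}` only, so its `Q`-conditional expectation
is constant; under `Q` the functional `wᵀ ε_{t+1}` is normal with mean `wᵀ λ_{t+1}`. -/
lemma condExp_put_step (𝓜 : GaussianModel P T n) {t : ℕ} (ht : t < T) (w : Fin n → ℝ) (r : ℝ)
    {F : Ω → ℝ} (hF : F =ᵐ[P] fun ω => max 0 (√(w ⬝ᵥ w) * r - w ⬝ᵥ 𝓜.ε (t + 1) ω)) :
    𝓜.Q[F | 𝓜.filt t] =ᵐ[P] fun _ =>
      ∫ e, max 0 (√(w ⬝ᵥ w) * (r - e) - w ⬝ᵥ 𝓜.lam (t + 1)) ∂(gaussianReal 0 1) := by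
  have := 𝓜.isProbabilityMeasure_Q
  have hmem : t + 1 ∈ Finset.Icc (t + 1) T := Finset.mem_Icc.2 ⟨le_rfl, ht⟩
  let h : ℝ → ℝ := fun x => max 0 (√(w ⬝ᵥ w) * r - w ⬝ᵥ 𝓜.lam (t + 1) - x)
  have hh : Measurable h := by fun_prop
  have hF' : F =ᵐ[𝓜.Q] fun ω => h (w ⬝ᵥ 𝓜.shifted.ε (t + 1) ω) := by
    filter_upwards [𝓜.Q_absolutelyContinuous.ae_le hF] with ω hω
    have : 𝓜.shifted.ε (t + 1) ω = 𝓜.ε (t + 1) ω - 𝓜.lam (t + 1) := rfl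
    rw [hω, this, dotProduct_sub]
    simp only [h]
    congr 1
    ring
  have hw : Measurable fun x : Fin n → ℝ => h (w ⬝ᵥ x) := hh.comp (by fun_prop)
  have hind := 𝓜.shifted.indep_filt_future ht.le
  rw [shifted_filt] at hind
  have h1 := condExp_indep_eq (𝓜.shifted.future_le t) (𝓜.filt_le ht.le)
    (hw.comp (𝓜.shifted.measurable_eps_future hmem)).stronglyMeasurable hind.symm
  refine 𝓜.absolutelyContinuous_Q.ae_le ((condExp_congr_ae hF').trans (h1.trans ?_))
  refine Filter.Eventually.of_forall fun _ => ?_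
  have hlaw := 𝓜.shifted.hasLaw_dot_eps w (mem_Icc_one_of_future hmem)
  have h2 := hlaw.integral_comp (f := h) hh.aestronglyMeasurable
  rw [integral_map (by fun_prop) hh.aestronglyMeasurable] at h2
  refine Eq.trans h2 (integral_congr_ae (Filter.Eventually.of_forall fun e => ?_))
  simp only [h]
  congr 1
  ring

lemma phi_step (𝓜 : GaussianModel P T n) {M : Measure ℝ}
    (hM : IsQuantileWeight M) {t : ℕ} (ht : t < T) {Z Y : Ω → ℝ}
    (hZ : Measurable[𝓜.filt t] Z) (w : Fin n → ℝ)
    (hY : Y =ᵐ[P] fun ω => Z ω + w ⬝ᵥ 𝓜.ε (t + 1) ω) :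
    𝓜.phi M t Y =ᵐ[P] fun ω => Z ω + √(w ⬝ᵥ w) * rZero M -
      ∫ e, max 0 (√(w ⬝ᵥ w) * (rZero M - e) - w ⬝ᵥ 𝓜.lam (t + 1)) ∂(gaussianReal 0 1) := by
  have hR := 𝓜.rho_step hM ht hZ w hY
  have hput := 𝓜.condExp_put_step ht w (rZero M)
    (F := fun ω => max 0 (𝓜.rho M t (-Y) ω - Y ω)) (by
      filter_upwards [hR, hY] with ω h1 h2
      rw [h1, h2]
      congr 1
      ring)
  filter_upwards [hR, hput] with ω h1 h2
  rw [phi, Pi.sub_apply, h1, h2]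

end OneStep

/-! ### The value process -/

lemma measurable_affine_add_const (𝓜 : GaussianModel P T n) (a k : ℝ) (c : ℕ → Fin n → ℝ)
    {t : ℕ} (ht : t ≤ T) : Measurable[𝓜.filt t] fun ω => 𝓜.affine a c t ω + k :=
  (𝓜.measurable_affine a c ht).add_const k

lemma sqrt_tailLoad (𝓜 : GaussianModel P T n) (g : ℕ → Fin n → ℝ) (s : ℕ) :
    √(𝓜.tailLoad g s s ⬝ᵥ 𝓜.tailLoad g s s) = 𝓜.sigma g s := by
  rw [sigma, sigmaSq_eq]

lemma KP_eq_add (𝓜 : GaussianModel P T n) (M : Measure ℝ) (g : ℕ → Fin n → ℝ) {t : ℕ}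
    (ht : t < T) :
    𝓜.KP M g t
      = 𝓜.KP M g (t + 1) + (𝓜.sigma g (t + 1) * rZero M - 𝓜.callValue M g (t + 1)) := by
  rw [KP, KP, add_comm (∑ s ∈ _, _)]
  exact sum_Icc_eq_add_sum_Icc_succ (Nat.succ_le_of_lt ht) _

lemma KP_eq_KQ_add (𝓜 : GaussianModel P T n) (M : Measure ℝ) (g : ℕ → Fin n → ℝ) (t : ℕ) :
    𝓜.KP M g t = 𝓜.KQ M g t + ∑ s ∈ Finset.Icc (t + 1) T, 𝓜.drift g s := by
  rw [KP, KQ, ← Finset.sum_add_distrib]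
  exact Finset.sum_congr rfl fun s _ => by ring

section Value

variable [IsProbabilityMeasure P]

lemma X_add_V_step (𝓜 : GaussianModel P T n) (g : ℕ → Fin n → ℝ) {M : Measure ℝ} {t : ℕ}
    (ht : t < T)
    (hV : 𝓜.V M g (t + 1) =ᵐ[P] fun ω =>
      𝓜.affine (𝓜.tailMean g (t + 2)) (𝓜.tailLoad g (t + 2)) (t + 1) ω + 𝓜.KP M g (t + 1)) :
    𝓜.X g (t + 1) + 𝓜.V M g (t + 1) =ᵐ[P] fun ω =>
      (𝓜.affine (𝓜.tailMean g (t + 1)) (𝓜.tailLoad g (t + 1)) t ω + 𝓜.KP M g (t + 1))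
        + 𝓜.tailLoad g (t + 1) (t + 1) ⬝ᵥ 𝓜.ε (t + 1) ω := by
  filter_upwards [hV] with ω h
  rw [Pi.add_apply, h, ← add_assoc, 𝓜.X_add_affine_tail g ht]
  ring

/-- `V_t` is `E^P_t[∑_{u>t} X_u]`, in its explicit affine form, plus the constant `K^P_t`. -/
lemma V_ae_eq (𝓜 : GaussianModel P T n) (g : ℕ → Fin n → ℝ) {M : Measure ℝ}
    (hM : IsQuantileWeight M) {t : ℕ} (ht : t ≤ T) :
    𝓜.V M g t =ᵐ[P] fun ω =>
      𝓜.affine (𝓜.tailMean g (t + 1)) (𝓜.tailLoad g (t + 1)) t ω + 𝓜.KP M g t := by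
  induction ht using Nat.decreasingInduction with
  | self =>
    refine Filter.Eventually.of_forall fun ω => ?_
    rw [V, if_neg (lt_irrefl T)]
    simp [affine, tailMean, tailLoad, KP]
  | of_succ t ht ih =>
    rw [V, if_pos ht]
    filter_upwards [𝓜.phi_step hM ht (𝓜.measurable_affine_add_const _ _ _ ht.le) _
      (𝓜.X_add_V_step g ht ih)] with ω h
    rw [h, 𝓜.KP_eq_add M g ht, sqrt_tailLoad, ← drift_eq, callValue]
    ring

lemma X_add_V_ae_eq (𝓜 : GaussianModel P T n) (g : ℕ → Fin n → ℝ) {M : Measure ℝ}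
    (hM : IsQuantileWeight M) {t : ℕ} (ht : t < T) :
    𝓜.X g (t + 1) + 𝓜.V M g (t + 1) =ᵐ[P] fun ω =>
      (𝓜.affine (𝓜.tailMean g (t + 1)) (𝓜.tailLoad g (t + 1)) t ω + 𝓜.KP M g (t + 1))
        + 𝓜.tailLoad g (t + 1) (t + 1) ⬝ᵥ 𝓜.ε (t + 1) ω :=
  𝓜.X_add_V_step g ht (𝓜.V_ae_eq g hM ht)

lemma R_ae_eq (𝓜 : GaussianModel P T n) (g : ℕ → Fin n → ℝ) {M : Measure ℝ}
    (hM : IsQuantileWeight M) {t : ℕ} (ht : t < T) :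
    𝓜.R M g t =ᵐ[P] fun ω =>
      𝓜.affine (𝓜.tailMean g (t + 1)) (𝓜.tailLoad g (t + 1)) t ω
        + (𝓜.KP M g (t + 1) + 𝓜.sigma g (t + 1) * rZero M) := by
  filter_upwards [𝓜.rho_step hM ht (𝓜.measurable_affine_add_const _ _ _ ht.le) _
      (𝓜.X_add_V_ae_eq g hM ht)] with ω h
  rw [R, ← neg_add', h, sqrt_tailLoad, add_assoc]

lemma C_ae_eq (𝓜 : GaussianModel P T n) (g : ℕ → Fin n → ℝ) {M : Measure ℝ}
    (hM : IsQuantileWeight M) {t : ℕ} (ht : t < T) :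
    𝓜.C M g t =ᵐ[P] fun _ => 𝓜.callValue M g (t + 1) := by
  filter_upwards [𝓜.R_ae_eq g hM ht, 𝓜.V_ae_eq g hM ht.le] with ω h1 h2
  change 𝓜.R M g t ω - 𝓜.V M g t ω = _
  rw [h1, h2, 𝓜.KP_eq_add M g ht]
  ring

lemma sum_condExp_Q_X (𝓜 : GaussianModel P T n) (g : ℕ → Fin n → ℝ) {t : ℕ} (ht : t ≤ T) :
    (fun ω => ∑ s ∈ Finset.Icc (t + 1) T, (𝓜.Q[𝓜.X g s | 𝓜.filt t]) ω)
      =ᵐ[P] fun ω => 𝓜.affine (𝓜.tailMean g (t + 1)) (𝓜.tailLoad g (t + 1)) t ω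
        + ∑ s ∈ Finset.Icc (t + 1) T, 𝓜.drift g s := by
  have := 𝓜.isProbabilityMeasure_Q
  have h := 𝓜.shifted.sum_condExp_X g ht
  rw [shifted_X, shifted_filt] at h
  filter_upwards [𝓜.absolutelyContinuous_Q.ae_le h] with ω h
  rw [h, 𝓜.affine_tail_shifted g ht]

/-- Affine functionals of the innovations are affine functionals of the shifted innovations, and
hence `Q`-integrable. -/
lemma integrable_affine_Q (𝓜 : GaussianModel P T n) (a : ℝ) (c : ℕ → Fin n → ℝ) {t : ℕ}
    (ht : t ≤ T) : Integrable (𝓜.affine a c t) 𝓜.Q := by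
  have := 𝓜.isProbabilityMeasure_Q
  have h : 𝓜.affine a c t
      = 𝓜.shifted.affine (a + ∑ s ∈ Finset.Icc 1 t, c s ⬝ᵥ 𝓜.lam s) c t := by
    ext ω
    simp only [affine, shifted, dotProduct_sub, Finset.sum_sub_distrib]
    ring
  rw [h]
  exact (𝓜.shifted.memLp_affine _ _ ht ENNReal.one_ne_top).integrable le_rfl

lemma integrable_memLp_of_ae_eq_affine (𝓜 : GaussianModel P T n) {a k : ℝ}
    {c : ℕ → Fin n → ℝ} {t : ℕ} (ht : t ≤ T) {Y : Ω → ℝ}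
    (hY : Y =ᵐ[P] fun ω => 𝓜.affine a c t ω + k) :
    Integrable Y 𝓜.Q ∧ ∀ p : ℝ≥0∞, p ≠ ∞ → MemLp Y p P := by
  have := 𝓜.isProbabilityMeasure_Q
  exact ⟨((𝓜.integrable_affine_Q a c ht).add (integrable_const k)).congr
      (𝓜.Q_absolutelyContinuous.ae_le hY.symm),
    fun p hp => ((𝓜.memLp_affine a c ht hp).add (memLp_const k)).ae_eq hY.symm⟩

lemma condVar_sub_condVar (𝓜 : GaussianModel P T n) (g : ℕ → Fin n → ℝ) {s : ℕ}
    (hs : s ∈ Finset.Icc 1 T) :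
    (condVar (𝓜.filt (s - 1)) (fun ω => ∑ u ∈ Finset.Icc s T, 𝓜.X g u ω) P
        - condVar (𝓜.filt s) (fun ω => ∑ u ∈ Finset.Icc s T, 𝓜.X g u ω) P)
      =ᵐ[P] fun _ => 𝓜.sigmaSq g s := by
  obtain ⟨h1, h2⟩ := Finset.mem_Icc.1 hs
  simp_rw [sum_X_eq_affine]
  filter_upwards [𝓜.condVar_affine (𝓜.tailMean g s) (𝓜.tailLoad g s)
    (show s - 1 ≤ T by omega), 𝓜.condVar_affine (𝓜.tailMean g s) (𝓜.tailLoad g s) h2]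
    with ω h3 h4
  rw [Pi.sub_apply, h3, h4, Nat.sub_add_cancel h1, sigmaSq_eq, sub_eq_iff_eq_add]
  exact sum_Icc_eq_add_sum_Icc_succ h2 _

end Value

end GaussianModel

theorem mainTheorem9 {Ω : Type*} [MeasurableSpace Ω] (P : Measure Ω) [IsProbabilityMeasure P]
    {T n : ℕ} (𝓜 : GaussianModel P T n) (g : ℕ → Fin n → ℝ)
    (M : Measure ℝ) (hM : IsQuantileWeight M) :
    -- all integrals and conditional expectations that occur are well defined
    (IsProbabilityMeasure 𝓜.Q ∧
      IntegrableOn stdNormalQuantile (Ioo 0 1) M ∧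
      (∀ t ∈ Finset.Icc 1 T, Integrable (𝓜.X g t) 𝓜.Q ∧
        ∀ p : ℝ≥0∞, p ≠ ∞ → MemLp (𝓜.X g t) p P) ∧
      (∀ t ≤ T, Integrable (𝓜.V M g t) 𝓜.Q ∧
        ∀ p : ℝ≥0∞, p ≠ ∞ → MemLp (𝓜.V M g t) p P) ∧
      (∀ t < T, Integrable (𝓜.R M g t) 𝓜.Q ∧
        (∀ p : ℝ≥0∞, p ≠ ∞ → MemLp (𝓜.R M g t) p P) ∧
        ∀ᵐ ω ∂P, IntegrableOn
          (quantile (condLaw P (𝓜.filt t) (𝓜.X g (t + 1) + 𝓜.V M g (t + 1)) ω)) (Ioo 0 1) M)) ∧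
    -- the two representations of the residual liability value
    (∀ t ≤ T,
      𝓜.V M g t =ᵐ[P]
        (fun ω => (∑ s ∈ Finset.Icc (t + 1) T, (𝓜.Q[𝓜.X g s | 𝓜.filt t]) ω) + 𝓜.KQ M g t) ∧
      𝓜.V M g t =ᵐ[P]
        (fun ω => (∑ s ∈ Finset.Icc (t + 1) T, (P[𝓜.X g s | 𝓜.filt t]) ω) + 𝓜.KP M g t)) ∧
    -- the volatilities `σ_s`
    (∀ s ∈ Finset.Icc 1 T,
      (𝓜.sigma g s) ^ 2 =
        ∑ j ∈ Finset.Icc s T, ∑ k ∈ Finset.Icc s T,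
          g j ⬝ᵥ ((𝓜.B j s * (𝓜.B k s)ᵀ) *ᵥ g k) ∧
      (condVar (𝓜.filt (s - 1)) (fun ω => ∑ u ∈ Finset.Icc s T, 𝓜.X g u ω) P
          - condVar (𝓜.filt s) (fun ω => ∑ u ∈ Finset.Icc s T, 𝓜.X g u ω) P)
        =ᵐ[P] fun _ => (𝓜.sigma g s) ^ 2) ∧
    -- the value of the reference undertaking
    (∀ t < T, 𝓜.C M g t =ᵐ[P] fun _ => 𝓜.callValue M g (t + 1)) := by
  refine ⟨⟨𝓜.isProbabilityMeasure_Q, integrableOn_stdNormalQuantile hM,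
    fun t ht => 𝓜.integrable_memLp_of_ae_eq_affine (Finset.mem_Icc.1 ht).2 (k := 0)
      (Filter.Eventually.of_forall fun ω => by
        rw [𝓜.X_eq_affine g le_rfl]; exact (add_zero _).symm),
    fun t ht => 𝓜.integrable_memLp_of_ae_eq_affine ht (𝓜.V_ae_eq g hM ht),
    fun t ht => ?_⟩, fun t ht => ⟨?_, ?_⟩, fun s hs => ⟨𝓜.sigma_sq g s, ?_⟩,
    fun t ht => 𝓜.C_ae_eq g hM ht⟩
  · obtain ⟨h1, h2⟩ := 𝓜.integrable_memLp_of_ae_eq_affine ht.le (𝓜.R_ae_eq g hM ht)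
    exact ⟨h1, h2, 𝓜.integrableOn_quantile_step hM ht
      (𝓜.measurable_affine_add_const _ _ _ ht.le) _ (𝓜.X_add_V_ae_eq g hM ht)⟩
  · filter_upwards [𝓜.V_ae_eq g hM ht, 𝓜.sum_condExp_Q_X g ht] with ω h1 h2
    rw [h1, h2, 𝓜.KP_eq_KQ_add]
    ring
  · filter_upwards [𝓜.V_ae_eq g hM ht, 𝓜.sum_condExp_X g ht] with ω h1 h2
    rw [h1, h2]
  · rw [𝓜.sigma_sq]
    exact 𝓜.condVar_sub_condVar g hs
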